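/- Let $\mathcal X$ be a finite set of $n\ge 2$ alternatives and let $u=(u_{xz})_{x\ne z}\in\mathbb R^{n(n-1)}$ be the parameter vector of the full-rank context dependent random utility model (CDM), in which $x$ is chosen from $C\subseteq\mathcal X$, $x\in C$, with probability $$P_u(x\mid C)=\frac{\exp\big(\sum_{z\in C\setminus x}u_{xz}\big)}{\sum_{y\in C}\exp\big(\sum_{z\in C\setminus y}u_{yz}\big)}.$$ Let $C_1,\dots,C_m\subseteq\mathcal X$ be given choice sets of sizes $k_j=|C_j|\ge 2$, and let $k_{\max}=\max_j k_j$. Assume that they identify the CDM: if $u,v$ both have coordinate sum zero and $P_u(x\mid C_j)=P_v(x\mid C_j)$ for all $j$ and all $x\in C_j$, then $u=v$. Let $u^\star\in\mathcal U_B=\{u:\|u\|_\infty\le B,\ \mathbf 1^Tu=0\}$, let $y_1,\dots,y_m$ be independent with $\mathbb P(y_j=x)=P_{u^\star}(x\mid C_j)$ for $x\in C_j$, and let $\hat u_{\mathrm{MLE}}$ be a maximizer over $\mathcal U_B$ of the likelihood $u\mapsto\prod_j P_u(y_j\mid C_j)$. Let $E_j\in\{0,1\}^{n(n-1)\times k_j}$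 be the matrix whose column for $y\in C_j$ is the indicator of the coordinates $u_{yz}$, $z\in C_j\setminus y$, and let $$L=\frac1m\sum_{j=1}^m E_j\Big(I-\tfrac1{k_j}\mathbf 1\mathbf 1^T\Big)E_j^T .$$ Let $F_k(x)=e^{x_1}/\sum_{l=1}^k e^{x_l}$ and $\beta_k=\min_{x\in[-(k-1)B,(k-1)B]^k}\lambda_2\big(\nabla^2(-\log F_k)(x)\big)$, where $\lambda_2$ denotes the second smallest eigenvalue, counted with multiplicity. Let $G$ be the integer design matrix that has, for each $j$ and each $x\in C_j$, the row that maps $u$ to $\sum_{y\in C_j\setminus x}\big([u_{xy}-u_{yx}]+\sum_{z\in C_j\setminus\{x,y\}}[u_{xz}-u_{yz}]\big)$, and let $X$ be $G$ with the rows of each $j$ divided by $k_j$. Then $L=\frac1mX^TX$, $\lambda_2(L)>0$ and $\beta_{k_{\max}}>0$, and with $c_{B,k_{\max}}=\dfrac{2}{\lambda_2(L)\,\beta_{k_{\max}}^2}$ and $d=n(n-1)-1$, $$\mathbb E\big[\|\hat u_{\mathrm{MLE}}-u^\star\|_2^2\big]\le c_{B,k_{\max}}\,\frac{d-1}{m}\quad\text{if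 } n\ge 3,$$ and, for every $n\ge 2$, $$\mathbb E\big[\|\hat u_{\mathrm{MLE}}-u^\star\|_2^2\big]\le c_{B,k_{\max}}\,\frac{d}{m}.$$ -/

import Mathlib

/-- Ordered pairs of distinct alternatives: the coordinates `u_{xz}` (`x ≠ z`) of a full-rank
context dependent random utility model (CDM). There are `n (n - 1)` of them. -/
abbrev Pair (X : Type*) : Type _ := {p : X × X // p.1 ≠ p.2}

section CDM

variable {X : Type*} [Fintype X] [DecidableEq X]

/-- The utility `∑_{z ∈ C \ x} u_{xz}` of `x` in the context of the choice set `C`. -/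
noncomputable def utility (u : EuclideanSpace ℝ (Pair X)) (C : Finset X) (x : X) : ℝ :=
  ∑ p : Pair X with p.1.1 = x ∧ p.1.2 ∈ C, u p

/-- The CDM probability `P(x ∣ C)` of choosing `x` from `C` (meaningful for `x ∈ C`). -/
noncomputable def choiceProb (u : EuclideanSpace ℝ (Pair X)) (C : Finset X) (x : X) : ℝ :=
  Real.exp (utility u C x) / ∑ y ∈ C, Real.exp (utility u C y)

/-- A collection of choice sets identifies the CDM: two parameter vectors, each summing to zero,
that have the same choice probabilities on all sets of the collection are equal. -/
def IdentifiesCDM (𝒞 : Set (Finset X)) : Prop :=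
  ∀ u v : EuclideanSpace ℝ (Pair X), ∑ p, u p = 0 → ∑ p, v p = 0 →
    (∀ S ∈ 𝒞, ∀ x ∈ S, choiceProb u S x = choiceProb v S x) → u = v

/-- The parameter set `𝒰_B`: sup-norm at most `B`, and sum zero. -/
def paramSet (X : Type*) [Fintype X] [DecidableEq X] (B : ℝ) :
    Set (EuclideanSpace ℝ (Pair X)) :=
  {u | (∀ p, |u p| ≤ B) ∧ ∑ p, u p = 0}

/-- The likelihood of the dataset in which `s j` is chosen from `C j` for every `j`. -/
noncomputable def likelihood {m : ℕ} (C : Fin m → Finset X) (s : Fin m → X)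
    (u : EuclideanSpace ℝ (Pair X)) : ℝ :=
  ∏ j, choiceProb u (C j) (s j)

/-- `v` is a maximum likelihood estimate over `𝒰_B` for the dataset `(s j, C j)_j`. -/
def IsMLE {m : ℕ} (B : ℝ) (C : Fin m → Finset X) (s : Fin m → X)
    (v : EuclideanSpace ℝ (Pair X)) : Prop :=
  v ∈ paramSet X B ∧ IsMaxOn (likelihood C s) (paramSet X B) v

/-- The number `d = n (n - 1) - 1` of free parameters of the full-rank CDM, as a real number. -/
def numFreeParams (X : Type*) [Fintype X] : ℝ :=
  (Fintype.card X : ℝ) * ((Fintype.card X : ℝ) - 1) - 1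

/-- The largest choice set size in the dataset. -/
def kMax {m : ℕ} (C : Fin m → Finset X) : ℕ :=
  Finset.univ.sup fun j => (C j).card

/-- The matrix with one column for each `y ∈ C`, which has a one at the position of each
`u_{yz}`, `z ∈ C \ y`, and zeros elsewhere; so `uᵀ E` is the vector of utilities on `C`. -/
def incidence (C : Finset X) : Matrix (Pair X) C ℝ :=
  Matrix.of fun p y => if p.1.1 = (y : X) ∧ p.1.2 ∈ C then 1 else 0

/-- The centering matrix `I - (1/k) 𝟏 𝟏ᵀ` on a choice set `C` of size `k`. -/
noncomputable def centering (C : Finset X) : Matrix C C ℝ :=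
  1 - (1 / (C.card : ℝ)) • (Matrix.of fun _ _ => 1 : Matrix C C ℝ)

/-- `L = (1/m) ∑_j E_j (I - (1/k_j) 𝟏 𝟏ᵀ) E_jᵀ`, with `k_j` the size of the `j`-th set. -/
noncomputable def lapL {m : ℕ} (C : Fin m → Finset X) : Matrix (Pair X) (Pair X) ℝ :=
  (1 / (m : ℝ)) • ∑ j, incidence (C j) * centering (C j) * (incidence (C j)).transpose

/-- The coefficient vector of `u_{ab}`, as a linear form in `u`. -/
def coordForm (a b : X) : Pair X → ℤ :=
  fun p => if p.1 = (a, b) then 1 else 0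

/-- The integer design matrix `G` of the dataset. It has a row for each datapoint `j` and each
`x ∈ C j`, which maps `u` to
`∑_{y ∈ C_j \ x} ((u_{xy} - u_{yx}) + ∑_{z ∈ C_j \ {x, y}} (u_{xz} - u_{yz}))`. -/
def designMatrix {m : ℕ} (C : Fin m → Finset X) : Matrix (Σ j, C j) (Pair X) ℤ :=
  Matrix.of fun r => ∑ y ∈ (C r.1).erase r.2, ((coordForm (r.2 : X) y - coordForm y (r.2 : X)) +
    ∑ z ∈ ((C r.1).erase r.2).erase y, (coordForm (r.2 : X) z - coordForm y z))

/-- The design matrix with the rows of each datapoint `j` divided by the size of `C j`. -/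
noncomputable def scaledDesignMatrix {m : ℕ} (C : Fin m → Finset X) :
    Matrix (Σ j, C j) (Pair X) ℝ :=
  Matrix.of fun r p => (designMatrix C r p : ℝ) / ((C r.1).card : ℝ)

end CDM

open Classical in
/-- The second smallest eigenvalue `λ₂(A)`, counted with multiplicity, of a real symmetric matrix
of size at least two (`eigenvalues₀` lists the eigenvalues in decreasing order). -/
noncomputable def lambdaTwo {ι : Type*} [Fintype ι] [DecidableEq ι] (A : Matrix ι ι ℝ) : ℝ :=
  if h : A.IsHermitian ∧ 2 ≤ Fintype.card ι then
    h.1.eigenvalues₀ ⟨Fintype.card ι - 2, by omega⟩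
  else 0

/-- `F_k(x) = exp(x_1) / ∑_l exp(x_l)`, for `k ≥ 1`. -/
noncomputable def firstChoiceProb (k : ℕ) (x : Fin k → ℝ) : ℝ :=
  if h : 0 < k then Real.exp (x ⟨0, h⟩) / ∑ l, Real.exp (x l) else 0

/-- The Hessian matrix `(∂_i ∂_j f)(x)`. -/
noncomputable def hessian {k : ℕ} (f : (Fin k → ℝ) → ℝ) (x : Fin k → ℝ) :
    Matrix (Fin k) (Fin k) ℝ :=
  Matrix.of fun i j => fderiv ℝ (fun z => fderiv ℝ f z (Pi.single j 1)) x (Pi.single i 1)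

/-- `β_k`, the minimum of `λ₂(∇²(-log F_k(x)))` over `x ∈ [-(k-1)B, (k-1)B]^k`. -/
noncomputable def cdmBeta (B : ℝ) (k : ℕ) : ℝ :=
  sInf ((fun x : Fin k → ℝ => lambdaTwo (hessian (fun z => -Real.log (firstChoiceProb k z)) x)) ''
    {x | ∀ i, |x i| ≤ ((k : ℝ) - 1) * B})

/-- The constant `c = 2 / (λ₂(L) β_{k_max}²)`. -/
noncomputable def cdmConst {X : Type*} [Fintype X] [DecidableEq X] {m : ℕ} (B : ℝ)
    (C : Fin m → Finset X) : ℝ :=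
  2 / (lambdaTwo (lapL C) * cdmBeta B (kMax C) ^ 2)

/-! The negative log-likelihood is a sum of functions log-sum-exp minus linear, so its derivatives
along a line are Gibbs means and its second derivatives are Gibbs variances. Everything is a
comparison of these variances with centred sums of squares of utilities, whose total over the
dataset is m wᵀLw.

Lower comparison: on the box of utilities that `paramSet` allows, each variance is at least β times
the centred sum of squares (`cdmBeta_mul_le_gibbsVar`). With w the estimation error, optimality of
the estimate along the segment from the true parameter gives β m wᵀLw ≤ score(w)
(`cdmBeta_mul_le_score`).

Upper comparison: Gibbs weights are at most 1, so by independence the expected squared score in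
direction v is at most m vᵀLv (`integral_score_sq_le`).

The two meet in an orthonormal eigenbasis b_i of L. Identifiability makes λ₂(L) positive, and since
L kills the constants, the error w, which sums to zero, has no component along the lowest
eigenvector. Young's inequality on each of the d remaining components gives (β m)² wᵀLw ≤ ∑
score(b_i)²/ev_i, where every summand has expectation at most m. Hence the risk is at most d /
(λ₂(L) β² m), half of the second claimed bound. The spare factor 2 also gives the bound with d - 1,
because d/2 ≤ d - 1 once n ≥ 3. -/

/-- The mean of `b` under the Gibbs distribution on `C` with weights `exp a`. -/
noncomputable def gibbsMean {ι : Type*} (C : Finset ι) (a b : ι → ℝ) : ℝ :=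
  (∑ x ∈ C, Real.exp (a x) * b x) / ∑ x ∈ C, Real.exp (a x)

/-- The variance of `b` under the Gibbs distribution on `C` with weights `exp a`. -/
noncomputable def gibbsVar {ι : Type*} (C : Finset ι) (a b : ι → ℝ) : ℝ :=
  gibbsMean C a (fun x => b x ^ 2) - gibbsMean C a b ^ 2

/-! ### Gibbs means and variances on a finite set. -/

section Gibbs

variable {ι : Type*} {C : Finset ι}

theorem sum_exp_pos (hC : C.Nonempty) (a : ι → ℝ) : 0 < ∑ x ∈ C, Real.exp (a x) :=
  Finset.sum_pos (fun _ _ => Real.exp_pos _) hC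

/-- Bias-variance decomposition; it lets a variance be compared with squared deviations from any
centre. -/
theorem gibbsMean_sq_sub (hC : C.Nonempty) (a b : ι → ℝ) (c : ℝ) :
    gibbsMean C a (fun x => (b x - c) ^ 2) =
      gibbsVar C a b + (gibbsMean C a b - c) ^ 2 := by
  have hZ := (sum_exp_pos hC a).ne'
  have h : ∑ x ∈ C, Real.exp (a x) * (b x - c) ^ 2 =
      ∑ x ∈ C, Real.exp (a x) * b x ^ 2 - 2 * c * ∑ x ∈ C, Real.exp (a x) * b x
        + c ^ 2 * ∑ x ∈ C, Real.exp (a x) := by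
    rw [Finset.mul_sum, Finset.mul_sum, ← Finset.sum_sub_distrib, ← Finset.sum_add_distrib]
    exact Finset.sum_congr rfl fun x _ => by ring
  unfold gibbsVar gibbsMean
  rw [h]
  field_simp
  ring

theorem gibbsMean_le_sum (a : ι → ℝ) {b : ι → ℝ} (hb : ∀ x ∈ C, 0 ≤ b x) :
    gibbsMean C a b ≤ ∑ x ∈ C, b x := by
  rw [gibbsMean, Finset.sum_div]
  refine Finset.sum_le_sum fun x hx => ?_
  rw [mul_div_right_comm]
  refine mul_le_of_le_one_left (hb x hx) (div_le_one_of_le₀ ?_ ?_)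
  · exact Finset.single_le_sum (f := fun y => Real.exp (a y)) (fun _ _ => (Real.exp_pos _).le) hx
  · exact Finset.sum_nonneg fun _ _ => (Real.exp_pos _).le

theorem sum_sub_average_sq (hC : C.Nonempty) (b : ι → ℝ) :
    ∑ x ∈ C, (b x - (∑ y ∈ C, b y) / C.card) ^ 2 =
      ∑ x ∈ C, b x ^ 2 - (∑ y ∈ C, b y) ^ 2 / C.card := by
  have hk : (C.card : ℝ) ≠ 0 := Nat.cast_ne_zero.mpr hC.card_pos.ne'
  simp only [sub_sq, Finset.sum_add_distrib, Finset.sum_sub_distrib, ← Finset.mul_sum,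
    ← Finset.sum_mul, Finset.sum_const, nsmul_eq_mul]
  field_simp
  ring

theorem sum_sub_average_sq_le (hC : C.Nonempty) (b : ι → ℝ) (c : ℝ) :
    ∑ x ∈ C, (b x - (∑ y ∈ C, b y) / C.card) ^ 2 ≤ ∑ x ∈ C, (b x - c) ^ 2 := by
  rw [sum_sub_average_sq hC]
  have hk : (0 : ℝ) < C.card := Nat.cast_pos.mpr hC.card_pos
  have h : ∑ x ∈ C, (b x - c) ^ 2 =
      ∑ x ∈ C, b x ^ 2 - 2 * (∑ y ∈ C, b y) * c + C.card * c ^ 2 := by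
    simp only [sub_sq, Finset.sum_add_distrib, Finset.sum_sub_distrib, ← Finset.mul_sum,
      ← Finset.sum_mul, Finset.sum_const, nsmul_eq_mul]
  have h2 : 0 ≤ (C.card : ℝ) * (c - (∑ y ∈ C, b y) / C.card) ^ 2 := by positivity
  have h3 : (C.card : ℝ) * (c - (∑ y ∈ C, b y) / C.card) ^ 2 =
      C.card * c ^ 2 - 2 * (∑ y ∈ C, b y) * c + (∑ y ∈ C, b y) ^ 2 / C.card := by
    field_simp
    ring
  linarith

/-- The variance is at most the mean squared deviation from the uniform average, and each Gibbs
weight is at most 1. This controls the noise without any use of the curvature constant. -/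
theorem gibbsVar_le_sum_sub_average_sq (hC : C.Nonempty) (a b : ι → ℝ) :
    gibbsVar C a b ≤ ∑ x ∈ C, (b x - (∑ y ∈ C, b y) / C.card) ^ 2 := by
  have h := gibbsMean_sq_sub hC a b ((∑ y ∈ C, b y) / C.card)
  have h2 := gibbsMean_le_sum (C := C) a
    (b := fun x => (b x - (∑ y ∈ C, b y) / C.card) ^ 2) fun _ _ => sq_nonneg _
  nlinarith [sq_nonneg (gibbsMean C a b - (∑ y ∈ C, b y) / C.card)]

/-- Weights bounded below by p turn the variance into p times a sum of squared deviations from the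
Gibbs mean, and the uniform average minimizes such sums. -/
theorem le_gibbsVar (hC : C.Nonempty) (a b : ι → ℝ) {p : ℝ} (hp : 0 ≤ p)
    (ha : ∀ x ∈ C, p ≤ Real.exp (a x) / ∑ y ∈ C, Real.exp (a y)) :
    p * ∑ x ∈ C, (b x - (∑ y ∈ C, b y) / C.card) ^ 2 ≤ gibbsVar C a b := by
  have h := gibbsMean_sq_sub hC a b (gibbsMean C a b)
  rw [sub_self, zero_pow two_ne_zero, add_zero] at h
  rw [← h]
  refine (mul_le_mul_of_nonneg_left
    (sum_sub_average_sq_le hC b (gibbsMean C a b)) hp).trans ?_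
  generalize gibbsMean C a b = c
  rw [gibbsMean, Finset.sum_div, Finset.mul_sum]
  refine Finset.sum_le_sum fun x hx => ?_
  rw [mul_div_right_comm]
  exact mul_le_mul_of_nonneg_right (ha x hx) (sq_nonneg _)

theorem gibbs_weight_ge (hC : C.Nonempty) {a : ι → ℝ} {R : ℝ} (ha : ∀ x ∈ C, |a x| ≤ R)
    {x : ι} (hx : x ∈ C) :
    Real.exp (-R) / (C.card * Real.exp R) ≤ Real.exp (a x) / ∑ y ∈ C, Real.exp (a y) := by
  refine div_le_div₀ (Real.exp_pos _).le
    (Real.exp_le_exp.mpr (abs_le.mp (ha x hx)).1) (sum_exp_pos hC a) ?_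
  rw [← nsmul_eq_mul]
  exact Finset.sum_le_card_nsmul _ _ _ fun y hy => Real.exp_le_exp.mpr (abs_le.mp (ha y hy)).2

theorem hasDerivAt_sum_exp_line (a b w : ι → ℝ) (t : ℝ) :
    HasDerivAt (fun t : ℝ => ∑ x ∈ C, Real.exp (a x + t * b x) * w x)
      (∑ x ∈ C, Real.exp (a x + t * b x) * (b x * w x)) t := by
  refine HasDerivAt.fun_sum fun x _ => ?_
  have h : HasDerivAt (fun t : ℝ => a x + t * b x) (b x) t := by
    simpa using ((hasDerivAt_id t).mul_const (b x)).const_add (a x)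
  simpa [mul_assoc] using h.exp.mul_const (w x)

theorem hasDerivAt_log_sum_exp_line (hC : C.Nonempty) (a b : ι → ℝ) (t : ℝ) :
    HasDerivAt (fun t : ℝ => Real.log (∑ x ∈ C, Real.exp (a x + t * b x)))
      (gibbsMean C (fun x => a x + t * b x) b) t := by
  have h := hasDerivAt_sum_exp_line (C := C) a b (fun _ => 1) t
  simp only [mul_one] at h
  exact h.log (sum_exp_pos hC fun x => a x + t * b x).ne'

/-- The derivative is a Gibbs covariance; for `w = b` it is the variance, the second derivative of
log-sum-exp along the line. -/
theorem hasDerivAt_gibbsMean_line (hC : C.Nonempty) (a b w : ι → ℝ) (t : ℝ) :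
    HasDerivAt (fun t : ℝ => gibbsMean C (fun x => a x + t * b x) w)
      (gibbsMean C (fun x => a x + t * b x) (fun x => b x * w x) -
        gibbsMean C (fun x => a x + t * b x) b * gibbsMean C (fun x => a x + t * b x) w) t := by
  have h := hasDerivAt_sum_exp_line (C := C) a b (fun _ => 1) t
  simp only [mul_one] at h
  have hZ := (sum_exp_pos hC fun x => a x + t * b x).ne'
  convert! (hasDerivAt_sum_exp_line (C := C) a b w t).div h hZ using 1
  unfold gibbsMean
  field_simp

end Gibbs

/-! ### The second smallest eigenvalue and sum-zero vectors. -/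

-- Since `eigenvalues₀` is decreasing, the last index carries the smallest eigenvalue and the one
-- before it carries `lambdaTwo`.
open scoped Matrix in
theorem exists_eigenbasis_lambdaTwo {ι : Type*} [Fintype ι] [DecidableEq ι]
    {A : Matrix ι ι ℝ} (hA : A.IsHermitian) (h : 2 ≤ Fintype.card ι) :
    ∃ (b : OrthonormalBasis ι ℝ (EuclideanSpace ℝ ι)) (ev : ι → ℝ) (i₀ i₁ : ι), i₀ ≠ i₁ ∧
      (∀ i, A *ᵥ ⇑(b i) = ev i • ⇑(b i)) ∧ lambdaTwo A = ev i₁ ∧ ev i₀ ≤ ev i₁ ∧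
      ∀ i ≠ i₀, ev i₁ ≤ ev i := by
  classical
  let e : Fin (Fintype.card ι) ≃ ι := Fintype.equivOfCardEq (Fintype.card_fin _)
  have hev : ∀ k, hA.eigenvalues (e k) = hA.eigenvalues₀ k := fun k => by
    simp [Matrix.IsHermitian.eigenvalues, e]
  refine ⟨hA.eigenvectorBasis, hA.eigenvalues, e ⟨Fintype.card ι - 1, by omega⟩,
    e ⟨Fintype.card ι - 2, by omega⟩, ?_, hA.mulVec_eigenvectorBasis, ?_, ?_, ?_⟩
  · rw [Ne, e.injective.eq_iff, Fin.mk.injEq]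
    omega
  · rw [hev, lambdaTwo, dif_pos ⟨hA, h⟩]
  · rw [hev, hev]
    exact hA.eigenvalues₀_antitone (Fin.mk_le_mk.mpr (by omega))
  · intro i hi
    obtain ⟨k, rfl⟩ := e.surjective i
    rw [hev, hev]
    refine hA.eigenvalues₀_antitone (Fin.le_def.mpr ?_)
    rw [Ne, e.injective.eq_iff, Fin.ext_iff] at hi
    have := k.2
    simp only at hi ⊢
    omega

section Spectral

open scoped Matrix RealInnerProductSpace

variable {ι : Type*} [Fintype ι] {A : Matrix ι ι ℝ}

theorem dotProduct_mulVec_eq_sum_eigen {b : OrthonormalBasis ι ℝ (EuclideanSpace ℝ ι)}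
    {ev : ι → ℝ} (hb : ∀ i, A *ᵥ ⇑(b i) = ev i • ⇑(b i)) (u v : EuclideanSpace ℝ ι) :
    (v : ι → ℝ) ⬝ᵥ A *ᵥ (u : ι → ℝ) = ∑ i, ev i * (⟪b i, v⟫ * ⟪b i, u⟫) := by
  have hu : (u : ι → ℝ) = ∑ i, ⟪b i, u⟫ • (b i : ι → ℝ) := by
    conv_lhs => rw [← b.sum_repr' u]
    simp
  have h : ∀ i, (v : ι → ℝ) ⬝ᵥ (b i : ι → ℝ) = ⟪b i, v⟫ := fun i => by
    rw [EuclideanSpace.inner_eq_star_dotProduct]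
    simp
  conv_lhs => rw [hu]
  rw [Matrix.mulVec_sum, dotProduct_sum]
  refine Finset.sum_congr rfl fun i _ => ?_
  rw [Matrix.mulVec_smul, hb, dotProduct_smul, dotProduct_smul, h]
  simp only [smul_eq_mul]
  ring

theorem norm_sq_eq_sum_inner_sq (b : OrthonormalBasis ι ℝ (EuclideanSpace ℝ ι))
    (u : EuclideanSpace ℝ ι) : ‖u‖ ^ 2 = ∑ i, ⟪b i, u⟫ ^ 2 := by
  rw [← b.sum_sq_norm_inner_right u]
  simp

/-- The span of the two lowest eigenvectors is a plane, so it meets the hyperplane of sum-zero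
vectors in a nonzero vector, and on that plane the Rayleigh quotient is at most λ₂. This makes λ₂
bounded below by any bound for the form on sum-zero vectors. -/
theorem exists_le_lambdaTwo [DecidableEq ι] (hA : A.IsHermitian) (h : 2 ≤ Fintype.card ι) :
    ∃ w : EuclideanSpace ℝ ι, w ≠ 0 ∧ ∑ i, w i = 0 ∧
      (w : ι → ℝ) ⬝ᵥ A *ᵥ (w : ι → ℝ) ≤ lambdaTwo A * ‖w‖ ^ 2 := by
  obtain ⟨b, ev, i₀, i₁, hne, hb, hl, hle, -⟩ := exists_eigenbasis_lambdaTwo hA h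
  obtain ⟨s, t, hst, hsum⟩ : ∃ s t : ℝ, (s ≠ 0 ∨ t ≠ 0) ∧
      s * ∑ i, b i₀ i + t * ∑ i, b i₁ i = 0 := by
    by_cases h0 : ∑ i, b i₀ i = 0
    · exact ⟨1, 0, by simp, by simp [h0]⟩
    · exact ⟨∑ i, b i₁ i, -∑ i, b i₀ i, by simp [h0], by ring⟩
  have hin : ∀ i, ⟪b i, s • b i₀ + t • b i₁⟫ =
      (if i = i₀ then s else 0) + (if i = i₁ then t else 0) := fun i => by
    simp [inner_add_right, inner_smul_right, OrthonormalBasis.inner_eq_ite]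
  have hsq : ∀ i, ⟪b i, s • b i₀ + t • b i₁⟫ * ⟪b i, s • b i₀ + t • b i₁⟫ =
      (if i = i₀ then s ^ 2 else 0) + (if i = i₁ then t ^ 2 else 0) := fun i => by
    rw [hin]
    by_cases h0 : i = i₀
    · subst h0
      simp [hne, sq]
    · by_cases h2 : i = i₁ <;> simp [h0, h2, hne.symm, sq]
  have hnorm : ‖s • b i₀ + t • b i₁‖ ^ 2 = s ^ 2 + t ^ 2 := by
    rw [norm_sq_eq_sum_inner_sq b]
    simp [sq (inner ℝ _ _), hsq, Finset.sum_add_distrib]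
  refine ⟨s • b i₀ + t • b i₁, ?_, ?_, ?_⟩
  · intro h0
    rw [h0, norm_zero] at hnorm
    rcases hst with hs | hs <;> have := sq_pos_of_ne_zero hs <;>
      nlinarith [sq_nonneg s, sq_nonneg t]
  · simpa [Finset.sum_add_distrib, ← Finset.mul_sum] using hsum
  · rw [dotProduct_mulVec_eq_sum_eigen hb, hnorm, hl]
    simp only [hsq, mul_add, mul_ite, mul_zero, Finset.sum_add_distrib, Finset.sum_ite_eq',
      Finset.mem_univ, if_true]
    nlinarith [sq_nonneg s]

/-- The constant vector lies in the kernel, hence is orthogonal to every eigenvector with positive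
eigenvalue. Only `b i₀` is left, so the constants are spanned by it and sum-zero vectors are
orthogonal to it. -/
theorem exists_eigenbasis_of_mulVec_one [DecidableEq ι] (hA : A.IsHermitian) (h : 2 ≤ Fintype.card ι)
    (h1 : A *ᵥ 1 = 0) (hpos : 0 < lambdaTwo A) :
    ∃ (b : OrthonormalBasis ι ℝ (EuclideanSpace ℝ ι)) (ev : ι → ℝ) (i₀ : ι),
      (∀ i, A *ᵥ ⇑(b i) = ev i • ⇑(b i)) ∧ (∀ i ≠ i₀, lambdaTwo A ≤ ev i) ∧
      ∀ u : EuclideanSpace ℝ ι, ∑ i, u i = 0 → ⟪b i₀, u⟫ = 0 := by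
  obtain ⟨b, ev, i₀, i₁, hne, hb, hl, hle, hge⟩ := exists_eigenbasis_lambdaTwo hA h
  refine ⟨b, ev, i₀, hb, fun i hi => hl ▸ hge i hi, fun u hu => ?_⟩
  let e : EuclideanSpace ℝ ι := WithLp.toLp 2 1
  have he : ∀ i ≠ i₀, ⟪b i, e⟫ = 0 := fun i hi => by
    have h2 := dotProduct_mulVec_eq_sum_eigen hb e (b i)
    have h3 : A *ᵥ (e : ι → ℝ) = 0 := h1
    rw [h3, dotProduct_zero] at h2
    simp only [OrthonormalBasis.inner_eq_ite, ite_mul, one_mul, zero_mul, mul_ite, mul_zero,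
      Finset.sum_ite_eq', Finset.mem_univ, if_true] at h2
    exact (mul_eq_zero.mp h2.symm).resolve_left (hpos.trans_le (hl ▸ hge i hi)).ne'
  have hexp : e = ⟪b i₀, e⟫ • b i₀ := by
    conv_lhs => rw [← b.sum_repr' e]
    exact Finset.sum_eq_single i₀ (fun i _ hi => by rw [he i hi, zero_smul]) (by simp)
  have heu : ⟪e, u⟫ = 0 := by
    rw [EuclideanSpace.inner_eq_star_dotProduct]
    simpa [e, dotProduct] using hu
  rw [hexp, inner_smul_left] at heu
  refine (mul_eq_zero.mp heu).resolve_left fun h0 => ?_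
  have h0' : ⟪b i₀, e⟫ = 0 := by simpa using h0
  rw [h0', zero_smul] at hexp
  -- Any coordinate would do: the vector of ones is not zero.
  have := congrArg (fun v : EuclideanSpace ℝ ι => v i₀) hexp
  simp [e] at this

theorem lambdaTwo_mul_norm_sq_le [DecidableEq ι] (hA : A.IsHermitian) (h : 2 ≤ Fintype.card ι)
    (h1 : A *ᵥ 1 = 0) (hpos : 0 < lambdaTwo A) {u : EuclideanSpace ℝ ι} (hu : ∑ i, u i = 0) :
    lambdaTwo A * ‖u‖ ^ 2 ≤ (u : ι → ℝ) ⬝ᵥ A *ᵥ (u : ι → ℝ) := by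
  obtain ⟨b, ev, i₀, hb, hge, h0⟩ := exists_eigenbasis_of_mulVec_one hA h h1 hpos
  rw [dotProduct_mulVec_eq_sum_eigen hb, norm_sq_eq_sum_inner_sq b, Finset.mul_sum]
  refine Finset.sum_le_sum fun i _ => ?_
  by_cases hi : i = i₀
  · rw [hi, h0 u hu]
    simp
  · rw [← sq]
    exact mul_le_mul_of_nonneg_right (hge i hi) (sq_nonneg _)

end Spectral

/-! ### The Hessian of -log F_k and positivity of β. -/

section Hessian

open scoped Matrix

variable {k : ℕ}

theorem univ_fin_nonempty (hk : 0 < k) : (Finset.univ : Finset (Fin k)).Nonempty :=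
  ⟨⟨0, hk⟩, Finset.mem_univ _⟩

theorem neg_log_firstChoiceProb (hk : 0 < k) (z : Fin k → ℝ) :
    -Real.log (firstChoiceProb k z) = Real.log (∑ l, Real.exp (z l)) - z ⟨0, hk⟩ := by
  rw [firstChoiceProb, dif_pos hk, Real.log_div (Real.exp_pos _).ne'
    (sum_exp_pos (univ_fin_nonempty hk) z).ne', Real.log_exp]
  ring

theorem fderiv_eq_of_hasDerivAt_line {E : Type*} [NormedAddCommGroup E] [NormedSpace ℝ E]
    {f : E → ℝ} {x v : E} {f' : ℝ} (hf : DifferentiableAt ℝ f x)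
    (h : HasDerivAt (fun t : ℝ => f (x + t • v)) f' 0) : fderiv ℝ f x v = f' := by
  have h1 : HasFDerivAt f (fderiv ℝ f x) (x + (0 : ℝ) • v) := by
    simpa using hf.hasFDerivAt
  have h2 : HasDerivAt (fun t : ℝ => x + t • v) v 0 := by
    simpa using ((hasDerivAt_id (0 : ℝ)).smul_const v).const_add x
  exact (h1.comp_hasDerivAt (0 : ℝ) h2).unique h

theorem fderiv_neg_log_firstChoiceProb (hk : 0 < k) (z v : Fin k → ℝ) :
    fderiv ℝ (fun z => -Real.log (firstChoiceProb k z)) z v =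
      gibbsMean Finset.univ z v - v ⟨0, hk⟩ := by
  simp only [neg_log_firstChoiceProb hk]
  have hZ := fun z : Fin k → ℝ => (sum_exp_pos (univ_fin_nonempty hk) z).ne'
  refine fderiv_eq_of_hasDerivAt_line ?_ ?_
  · exact DifferentiableAt.sub (DifferentiableAt.log (by fun_prop) (hZ z)) (by fun_prop)
  · have h1 := hasDerivAt_log_sum_exp_line (univ_fin_nonempty hk) z v 0
    have h2 : HasDerivAt (fun t : ℝ => z ⟨0, hk⟩ + t * v ⟨0, hk⟩) (v ⟨0, hk⟩) 0 := by
      simpa using ((hasDerivAt_id (0 : ℝ)).mul_const (v ⟨0, hk⟩)).const_add (z ⟨0, hk⟩)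
    simpa using h1.fun_sub h2

/-- The chosen alternative enters -log F_k only through a linear term, so the Hessian is that of
log-sum-exp: the covariance matrix of the coordinate indicators. -/
theorem hessian_neg_log_firstChoiceProb (hk : 0 < k) (x : Fin k → ℝ) (i j : Fin k) :
    hessian (fun z => -Real.log (firstChoiceProb k z)) x i j =
      gibbsMean Finset.univ x (Pi.single i 1 * Pi.single j 1) -
        gibbsMean Finset.univ x (Pi.single i 1) * gibbsMean Finset.univ x (Pi.single j 1) := by
  simp only [hessian, Matrix.of_apply, fderiv_neg_log_firstChoiceProb hk]
  have hZ := fun z : Fin k → ℝ => (sum_exp_pos (univ_fin_nonempty hk) z).ne'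
  refine fderiv_eq_of_hasDerivAt_line ?_ ?_
  · unfold gibbsMean
    fun_prop (disch := exact hZ _)
  · have h := hasDerivAt_gibbsMean_line (univ_fin_nonempty hk) x (Pi.single i 1)
      (Pi.single j 1) 0
    simp only [zero_mul, add_zero] at h
    exact h.sub_const _

theorem gibbsMean_eq_sum (x b : Fin k → ℝ) :
    gibbsMean Finset.univ x b = ∑ i, gibbsMean Finset.univ x (Pi.single i 1) * b i := by
  simp [gibbsMean, Pi.single_apply, div_mul_eq_mul_div, Finset.sum_div]

theorem hessian_apply_eq_ite (hk : 0 < k) (x : Fin k → ℝ) (i j : Fin k) :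
    hessian (fun z => -Real.log (firstChoiceProb k z)) x i j =
      (if i = j then gibbsMean Finset.univ x (Pi.single j 1) else 0) -
        gibbsMean Finset.univ x (Pi.single i 1) * gibbsMean Finset.univ x (Pi.single j 1) := by
  rw [hessian_neg_log_firstChoiceProb hk]
  congr 1
  by_cases h : i = j
  · subst h
    rw [if_pos rfl, ← Pi.single_mul]
    simp
  · rw [if_neg h]
    have : (Pi.single i 1 * Pi.single j 1 : Fin k → ℝ) = 0 := by
      ext l
      by_cases hl : l = i
      · subst hl
        simp [h]
      · simp [hl]
    rw [this]
    simp [gibbsMean]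

theorem hessian_isHermitian (hk : 0 < k) (x : Fin k → ℝ) :
    (hessian (fun z => -Real.log (firstChoiceProb k z)) x).IsHermitian := by
  ext i j
  rw [Matrix.conjTranspose_apply, star_trivial, hessian_neg_log_firstChoiceProb hk,
    hessian_neg_log_firstChoiceProb hk, mul_comm (Pi.single j (1 : ℝ) : Fin k → ℝ)]
  ring

theorem hessian_mulVec (hk : 0 < k) (x b : Fin k → ℝ) (i : Fin k) :
    (hessian (fun z => -Real.log (firstChoiceProb k z)) x *ᵥ b) i =
      gibbsMean Finset.univ x (Pi.single i 1) * (b i - gibbsMean Finset.univ x b) := by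
  simp only [Matrix.mulVec, dotProduct, hessian_apply_eq_ite hk, sub_mul, ite_mul, zero_mul,
    Finset.sum_sub_distrib, Finset.sum_ite_eq, Finset.mem_univ, if_true]
  rw [gibbsMean_eq_sum x b, mul_sub, Finset.mul_sum]
  simp only [mul_assoc]

theorem dotProduct_hessian_mulVec (hk : 0 < k) (x b : Fin k → ℝ) :
    b ⬝ᵥ hessian (fun z => -Real.log (firstChoiceProb k z)) x *ᵥ b =
      gibbsVar Finset.univ x b := by
  simp only [dotProduct, hessian_mulVec hk]
  rw [gibbsVar, gibbsMean_eq_sum x fun i => b i ^ 2, sq (gibbsMean _ _ _)]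
  conv_rhs => enter [2, 1]; rw [gibbsMean_eq_sum]
  rw [Finset.sum_mul, ← Finset.sum_sub_distrib]
  exact Finset.sum_congr rfl fun i _ => by ring

theorem hessian_mulVec_one (hk : 0 < k) (x : Fin k → ℝ) :
    hessian (fun z => -Real.log (firstChoiceProb k z)) x *ᵥ 1 = 0 := by
  ext i
  have hZ := (sum_exp_pos (univ_fin_nonempty hk) x).ne'
  rw [hessian_mulVec hk]
  simp [gibbsMean, hZ]

/-- On the box every softmax weight is bounded below, hence so is the variance of a sum-zero vector
of given norm. The bound is uniform in `x`, so it yields both positivity of the infimum `cdmBeta`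
and the boundedness below needed to compare it with a value; attainment plays no role. -/
theorem lambdaTwo_hessian_ge (hk : 2 ≤ k) {x : Fin k → ℝ} {R : ℝ} (hx : ∀ i, |x i| ≤ R) :
    Real.exp (-R) / (k * Real.exp R) ≤
      lambdaTwo (hessian (fun z => -Real.log (firstChoiceProb k z)) x) := by
  have hk0 : 0 < k := by omega
  obtain ⟨w, hw0, hw1, hw⟩ := exists_le_lambdaTwo (hessian_isHermitian hk0 x) (by simpa using hk)
  rw [dotProduct_hessian_mulVec hk0] at hw
  have h := le_gibbsVar (univ_fin_nonempty hk0) x (w : Fin k → ℝ)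
    (p := Real.exp (-R) / (k * Real.exp R)) (by positivity) (fun i hi => by
      simpa using gibbs_weight_ge (univ_fin_nonempty hk0) (fun i _ => hx i) hi)
  have hn : 0 < ‖w‖ ^ 2 := by positivity
  rw [hw1] at h
  simp only [zero_div, sub_zero] at h
  have h2 : ‖w‖ ^ 2 = ∑ i, w i ^ 2 := by
    simp [EuclideanSpace.norm_sq_eq]
  rw [← h2] at h
  exact le_of_mul_le_mul_right (h.trans hw) hn

theorem cdmBeta_pos {B : ℝ} (hB : 0 ≤ B) (hk : 2 ≤ k) : 0 < cdmBeta B k := by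
  have h1 : (0 : ℝ) ≤ ((k : ℝ) - 1) * B := by
    have : (2 : ℝ) ≤ k := by exact_mod_cast hk
    exact mul_nonneg (by linarith) hB
  have hk0 : (0 : ℝ) < k := by exact_mod_cast (by omega : 0 < k)
  refine lt_of_lt_of_le (b := Real.exp (-(((k : ℝ) - 1) * B)) /
    (k * Real.exp (((k : ℝ) - 1) * B))) (by positivity) (le_csInf ?_ ?_)
  · exact ⟨_, 0, fun i => by simpa using h1, rfl⟩
  · rintro _ ⟨x, hx, rfl⟩
    exact lambdaTwo_hessian_ge hk hx

theorem cdmBeta_le_lambdaTwo {B : ℝ} (hk : 2 ≤ k) {x : Fin k → ℝ}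
    (hx : ∀ i, |x i| ≤ ((k : ℝ) - 1) * B) :
    cdmBeta B k ≤ lambdaTwo (hessian (fun z => -Real.log (firstChoiceProb k z)) x) := by
  refine csInf_le ⟨Real.exp (-(((k : ℝ) - 1) * B)) / (k * Real.exp (((k : ℝ) - 1) * B)), ?_⟩
    ⟨x, hx, rfl⟩
  rintro _ ⟨z, hz, rfl⟩
  exact lambdaTwo_hessian_ge hk hz

/-- The spectral bound is applied to the centred `b`; as the Hessian annihilates constants, centring
leaves the variance unchanged. -/
theorem cdmBeta_mul_le_gibbsVar_fin {B : ℝ} (hB : 0 ≤ B) (hk : 2 ≤ k) {x : Fin k → ℝ}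
    (hx : ∀ i, |x i| ≤ ((k : ℝ) - 1) * B) (b : Fin k → ℝ) :
    cdmBeta B k * ∑ i, (b i - (∑ j, b j) / k) ^ 2 ≤ gibbsVar Finset.univ x b := by
  have hk0 : 0 < k := by omega
  have hk1 : (k : ℝ) ≠ 0 := by exact_mod_cast hk0.ne'
  have hle := cdmBeta_le_lambdaTwo hk hx
  have hpos := (cdmBeta_pos hB hk).trans_le hle
  let u : EuclideanSpace ℝ (Fin k) := WithLp.toLp 2 fun i => b i - (∑ j, b j) / k
  have hu : ∑ i, u i = 0 := by
    simp only [u, Finset.sum_sub_distrib, Finset.sum_const, Finset.card_univ, Fintype.card_fin,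
      nsmul_eq_mul]
    field_simp
    ring
  have h := lambdaTwo_mul_norm_sq_le (hessian_isHermitian hk0 x) (by simpa using hk)
    (hessian_mulVec_one hk0 x) hpos hu
  have hn : ‖u‖ ^ 2 = ∑ i, (b i - (∑ j, b j) / k) ^ 2 := by
    simp [EuclideanSpace.norm_sq_eq, u]
  have hA : hessian (fun z => -Real.log (firstChoiceProb k z)) x *ᵥ (u : Fin k → ℝ) =
      hessian (fun z => -Real.log (firstChoiceProb k z)) x *ᵥ b := by
    have : (u : Fin k → ℝ) = b - ((∑ j, b j) / k) • 1 := by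
      ext i
      simp [u]
    rw [this, Matrix.mulVec_sub, Matrix.mulVec_smul, hessian_mulVec_one hk0, smul_zero, sub_zero]
  rw [dotProduct_hessian_mulVec hk0] at h
  have hv : gibbsVar Finset.univ x (u : Fin k → ℝ) = gibbsVar Finset.univ x b := by
    rw [← dotProduct_hessian_mulVec hk0, hA, ← dotProduct_hessian_mulVec hk0]
    have : (u : Fin k → ℝ) = b - ((∑ j, b j) / k) • 1 := by
      ext i
      simp [u]
    rw [this, sub_dotProduct, smul_dotProduct, Matrix.dotProduct_mulVec 1,
      ← Matrix.mulVec_transpose]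
    have hT : (hessian (fun z => -Real.log (firstChoiceProb k z)) x)ᵀ =
        hessian (fun z => -Real.log (firstChoiceProb k z)) x := by
      simpa [Matrix.IsHermitian, Matrix.conjTranspose] using! hessian_isHermitian hk0 x
    rw [hT, hessian_mulVec_one hk0]
    simp
  rw [hv, hn] at h
  exact (mul_le_mul_of_nonneg_right hle (Finset.sum_nonneg fun _ _ => sq_nonneg _)).trans h

end Hessian

/-- Enlarging the choice set lowers the curvature constant. -/
theorem cdmBeta_mul_le_gibbsVar {ι : Type*} {C : Finset ι} (hC : C.Nonempty) {K : ℕ} {B : ℝ}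
    (hB : 0 ≤ B) (hK : 2 ≤ K) (hCK : C.card ≤ K) {a : ι → ℝ}
    (ha : ∀ x ∈ C, |a x| ≤ ((C.card : ℝ) - 1) * B) (b : ι → ℝ) :
    cdmBeta B K * ∑ x ∈ C, (b x - (∑ y ∈ C, b y) / C.card) ^ 2 ≤ gibbsVar C a b := by
  classical
  set M := gibbsMean C a b with hM
  -- `C` is padded to `K` points. The added points have utility 0, which stays in the box, and value
  -- equal to the Gibbs mean `M`, so that they contribute no deviation from `M`.
  let e : C ↪ Fin K := C.equivFin.toEmbedding.trans (Fin.castLEEmb hCK)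
  let z : Fin K → ℝ := Function.extend e (fun x => a x) 0
  let d : Fin K → ℝ := Function.extend e (fun x => b x) fun _ => M
  have hze : ∀ x, z (e x) = a x := fun x => e.injective.extend_apply _ _ x
  have hde : ∀ x, d (e x) = b x := fun x => e.injective.extend_apply _ _ x
  have hz0 : ∀ i, i ∉ Finset.univ.map e → z i = 0 := fun i hi =>
    Function.extend_apply' _ _ _ (by simpa using hi)
  have hd0 : ∀ i, i ∉ Finset.univ.map e → d i = M := fun i hi =>
    Function.extend_apply' _ _ _ (by simpa using hi)
  have hsplit : ∀ f : ℝ → ℝ → ℝ, ∑ i, f (z i) (d i) =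
      ∑ x ∈ C, f (a x) (b x) + ((Finset.univ.map e)ᶜ.card : ℝ) * f 0 M := fun f => by
    rw [← Finset.sum_add_sum_compl (Finset.univ.map e), Finset.sum_map]
    congr 1
    · simp only [hze, hde]
      exact Finset.sum_coe_sort C fun x => f (a x) (b x)
    · rw [← nsmul_eq_mul]
      refine Finset.sum_eq_card_nsmul fun i hi => ?_
      rw [Finset.mem_compl] at hi
      rw [hz0 i hi, hd0 i hi]
  have hk1 : (1 : ℝ) ≤ C.card := by exact_mod_cast hC.card_pos
  have hkK : (C.card : ℝ) ≤ K := by exact_mod_cast hCK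
  have hzb : ∀ i, |z i| ≤ ((K : ℝ) - 1) * B := fun i => by
    by_cases hi : i ∈ Finset.univ.map e
    · obtain ⟨x, -, rfl⟩ := Finset.mem_map.mp hi
      rw [hze]
      exact (ha x x.2).trans (mul_le_mul_of_nonneg_right (by linarith) hB)
    · rw [hz0 i hi, abs_zero]
      exact mul_nonneg (by linarith) hB
  have h := cdmBeta_mul_le_gibbsVar_fin hB hK hzb d
  have hβ := cdmBeta_pos hB hK
  have hne := univ_fin_nonempty (k := K) (by omega)
  refine (mul_le_mul_of_nonneg_left ?_ hβ.le).trans (h.trans ?_)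
  · refine (sum_sub_average_sq_le hC b ((∑ j, d j) / K)).trans ?_
    rw [hsplit fun _ t => (t - (∑ j, d j) / K) ^ 2]
    exact le_add_of_nonneg_right (by positivity)
  · have h1 := gibbsMean_sq_sub hne z d M
    have h2 := gibbsMean_sq_sub hC a b M
    rw [← hM, sub_self, zero_pow two_ne_zero, add_zero] at h2
    -- Padding leaves the numerator unchanged, since the added terms vanish, and only enlarges the
    -- partition function.
    have h3 : gibbsMean Finset.univ z (fun x => (d x - M) ^ 2) ≤
        gibbsMean C a (fun x => (b x - M) ^ 2) := by
      unfold gibbsMean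
      rw [hsplit fun s t => Real.exp s * (t - M) ^ 2, hsplit fun s _ => Real.exp s, sub_self,
        zero_pow two_ne_zero, mul_zero, mul_zero, add_zero]
      refine div_le_div_of_nonneg_left
        (Finset.sum_nonneg fun _ _ => mul_nonneg (Real.exp_pos _).le (sq_nonneg _))
        (sum_exp_pos hC a) (le_add_of_nonneg_right (by positivity))
    nlinarith [sq_nonneg (gibbsMean Finset.univ z d - M)]

/-! ### The design matrix, the Laplacian L and identifiability. -/

section Design

open scoped Matrix

variable {X : Type*} [DecidableEq X]

/-- Each `y` contributes the full utility of `x` minus that of `y`: the bracketed difference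
supplies the terms with `z = y` and `z = x`, and the diagonal of `c` vanishes. -/
theorem sum_erase_eq_card_mul_sub {S : Finset X} {x : X} (hx : x ∈ S) {c : X → X → ℤ}
    (hc : ∀ a, c a a = 0) :
    ∑ y ∈ S.erase x, ((c x y - c y x) + ∑ z ∈ (S.erase x).erase y, (c x z - c y z)) =
      S.card * ∑ z ∈ S, c x z - ∑ y ∈ S, ∑ z ∈ S, c y z := by
  have h : ∀ y ∈ S.erase x,
      (c x y - c y x) + ∑ z ∈ (S.erase x).erase y, (c x z - c y z) =
        ∑ z ∈ S, c x z - ∑ z ∈ S, c y z := fun y hy => by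
    have hyx : y ≠ x := (Finset.mem_erase.mp hy).1
    have hyS : y ∈ S := (Finset.mem_erase.mp hy).2
    have h1 : ∑ z ∈ S, c x z = c x y + ∑ z ∈ (S.erase x).erase y, c x z := by
      rw [← Finset.add_sum_erase S _ hx, hc, zero_add, Finset.add_sum_erase _ _ hy]
    have h2 : ∑ z ∈ S, c y z = c y x + ∑ z ∈ (S.erase x).erase y, c y z := by
      rw [← Finset.add_sum_erase S _ hx, ← Finset.add_sum_erase (S.erase x) _ hy, hc, zero_add]
    rw [h1, h2, Finset.sum_sub_distrib]
    ring
  rw [Finset.sum_congr rfl h, ← Finset.add_sum_erase S (fun y => ∑ z ∈ S, c y z) hx,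
    Finset.sum_sub_distrib, Finset.sum_const, nsmul_eq_mul, Finset.card_erase_of_mem hx,
    Nat.cast_sub (Finset.card_pos.mpr ⟨x, hx⟩)]
  push_cast
  ring

theorem coordForm_self (p : Pair X) (a : X) : coordForm a a p = 0 :=
  if_neg fun h => p.2 (by rw [h])

theorem sum_coordForm (S : Finset X) (x : X) (p : Pair X) :
    ∑ z ∈ S, coordForm x z p = if p.1.1 = x ∧ p.1.2 ∈ S then 1 else 0 := by
  simp only [coordForm, Prod.ext_iff, ite_and]
  split_ifs <;> simp_all

variable {m : ℕ} (C : Fin m → Finset X)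

theorem designMatrix_apply (r : Σ j, C j) (p : Pair X) :
    (designMatrix C r p : ℝ) = (C r.1).card * incidence (C r.1) p r.2 -
      ∑ y : C r.1, incidence (C r.1) p y := by
  have h : designMatrix C r p =
      ∑ y ∈ (C r.1).erase r.2, ((coordForm (r.2 : X) y p - coordForm y (r.2 : X) p) +
        ∑ z ∈ ((C r.1).erase r.2).erase y, (coordForm (r.2 : X) z p - coordForm y z p)) := by
    simp [designMatrix]
  rw [h, sum_erase_eq_card_mul_sub (c := fun a b => coordForm a b p) r.2.2
    (coordForm_self p)]
  simp only [sum_coordForm, incidence, Matrix.of_apply]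
  rw [Finset.sum_coe_sort (C r.1) fun y : X => if p.1.1 = y ∧ p.1.2 ∈ C r.1 then (1 : ℝ) else 0]
  push_cast
  rfl

theorem scaledDesignMatrix_apply (r : Σ j, C j) (p : Pair X) :
    scaledDesignMatrix C r p = incidence (C r.1) p r.2 -
      (∑ y : C r.1, incidence (C r.1) p y) / (C r.1).card := by
  have hk : ((C r.1).card : ℝ) ≠ 0 := by
    exact_mod_cast (Finset.card_pos.mpr ⟨_, r.2.2⟩).ne'
  rw [scaledDesignMatrix, Matrix.of_apply, designMatrix_apply]
  field_simp

theorem mul_centering_apply {κ : Type*} (S : Finset X) (E : Matrix κ S ℝ) (p : κ) (x : S) :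
    (E * centering S) p x = E p x - (∑ y, E p y) / S.card := by
  rw [centering, Matrix.mul_sub, Matrix.sub_apply, Matrix.mul_one]
  simp [Matrix.mul_apply, div_eq_mul_inv, Finset.sum_mul]

theorem mul_centering_mul_transpose {κ : Type*} (S : Finset X) (E : Matrix κ S ℝ) (p q : κ) :
    (E * centering S * Eᵀ) p q =
      ∑ x, (E p x - (∑ y, E p y) / S.card) * (E q x - (∑ y, E q y) / S.card) := by
  rw [Matrix.mul_apply]
  simp only [mul_centering_apply, Matrix.transpose_apply]
  -- Centred rows sum to zero, so centring one factor of the product already centres the other; this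
  -- is the idempotence of the centering matrix.
  have h : (∑ x, (E p x - (∑ y, E p y) / S.card)) * ((∑ y, E q y) / S.card) = 0 := by
    rcases S.eq_empty_or_nonempty with rfl | hS
    · simp
    · have hk : (S.card : ℝ) ≠ 0 := by exact_mod_cast hS.card_pos.ne'
      rw [Finset.sum_sub_distrib, Finset.sum_const, Finset.card_univ, Fintype.card_coe,
        nsmul_eq_mul]
      field_simp
      ring
  rw [← sub_zero (∑ x, _), ← h, Finset.sum_mul, ← Finset.sum_sub_distrib]
  exact Finset.sum_congr rfl fun x _ => by ring

theorem lapL_eq_smul_transpose_mul :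
    lapL C = (1 / (m : ℝ)) • ((scaledDesignMatrix C)ᵀ * scaledDesignMatrix C) := by
  rw [lapL]
  congr 1
  ext p q
  rw [Matrix.sum_apply, Matrix.mul_apply, Fintype.sum_sigma]
  refine Finset.sum_congr rfl fun j _ => ?_
  rw [mul_centering_mul_transpose]
  simp only [Matrix.transpose_apply, scaledDesignMatrix_apply]

theorem lapL_isHermitian : (lapL C).IsHermitian := by
  rw [lapL_eq_smul_transpose_mul, Matrix.IsHermitian,
    Matrix.conjTranspose_eq_transpose_of_trivial, Matrix.transpose_smul, Matrix.transpose_mul,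
    Matrix.transpose_transpose]

variable [Fintype X]

theorem utility_eq_sum_incidence (u : EuclideanSpace ℝ (Pair X)) (S : Finset X) (x : S) :
    utility u S x = ∑ p, incidence S p x * u p := by
  simp [utility, incidence, Finset.sum_filter]

theorem scaledDesignMatrix_mulVec (u : EuclideanSpace ℝ (Pair X)) (r : Σ j, C j) :
    (scaledDesignMatrix C *ᵥ (u : Pair X → ℝ)) r = utility u (C r.1) r.2 -
      (∑ y ∈ C r.1, utility u (C r.1) y) / (C r.1).card := by
  simp only [Matrix.mulVec, dotProduct, scaledDesignMatrix_apply, sub_mul,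
    Finset.sum_sub_distrib, ← utility_eq_sum_incidence]
  congr 1
  rw [← Finset.sum_coe_sort (C r.1)]
  simp only [utility_eq_sum_incidence, div_mul_eq_mul_div, Finset.sum_mul, ← Finset.sum_div]
  rw [Finset.sum_comm]

theorem dotProduct_lapL_mulVec (u : EuclideanSpace ℝ (Pair X)) :
    (u : Pair X → ℝ) ⬝ᵥ lapL C *ᵥ (u : Pair X → ℝ) = (1 / (m : ℝ)) * ∑ j, ∑ x ∈ C j,
      (utility u (C j) x - (∑ y ∈ C j, utility u (C j) y) / (C j).card) ^ 2 := by
  rw [lapL_eq_smul_transpose_mul, Matrix.smul_mulVec, dotProduct_smul, smul_eq_mul,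
    ← Matrix.mulVec_mulVec, Matrix.dotProduct_mulVec, Matrix.vecMul_transpose, dotProduct,
    Fintype.sum_sigma]
  congr 1
  refine Finset.sum_congr rfl fun j _ => ?_
  rw [← Finset.sum_coe_sort (C j)]
  exact Finset.sum_congr rfl fun x _ => by rw [scaledDesignMatrix_mulVec, sq]

theorem card_filter_pair {S : Finset X} {x : X} (hx : x ∈ S) :
    ((Finset.univ.filter fun p : Pair X => p.1.1 = x ∧ p.1.2 ∈ S).card : ℝ) =
      (S.card : ℝ) - 1 := by
  have h : (Finset.univ.filter fun p : Pair X => p.1.1 = x ∧ p.1.2 ∈ S).card =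
      (S.erase x).card := by
    refine Finset.card_bij (fun p _ => p.1.2) ?_ ?_ ?_
    · intro p hp
      rw [Finset.mem_filter] at hp
      exact Finset.mem_erase.mpr ⟨fun h => p.2 (hp.2.1.trans h.symm), hp.2.2⟩
    · intro p hp q hq h
      rw [Finset.mem_filter] at hp hq
      exact Subtype.ext (Prod.ext (hp.2.1.trans hq.2.1.symm) h)
    · intro z hz
      rw [Finset.mem_erase] at hz
      exact ⟨⟨(x, z), hz.1.symm⟩, by simp [hz.2], rfl⟩
  rw [h, Finset.card_erase_of_mem hx, Nat.cast_sub (Finset.card_pos.mpr ⟨x, hx⟩), Nat.cast_one]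

theorem utility_one {S : Finset X} {x : X} (hx : x ∈ S) :
    utility (WithLp.toLp 2 1 : EuclideanSpace ℝ (Pair X)) S x = (S.card : ℝ) - 1 := by
  simp only [utility, Pi.one_apply, Finset.sum_const, nsmul_eq_mul, mul_one, card_filter_pair hx]

/-- The all-ones parameter gives every alternative of a set of size k the same utility k - 1, which
centring removes. -/
theorem lapL_mulVec_one : lapL C *ᵥ 1 = 0 := by
  have h : scaledDesignMatrix C *ᵥ 1 = 0 := by
    ext r
    have hk : ((C r.1).card : ℝ) ≠ 0 := by
      exact_mod_cast (Finset.card_pos.mpr ⟨_, r.2.2⟩).ne'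
    refine (scaledDesignMatrix_mulVec C (WithLp.toLp 2 1) r).trans ?_
    rw [Finset.sum_congr rfl fun y hy => utility_one hy, utility_one r.2.2, Finset.sum_const,
      nsmul_eq_mul, mul_div_cancel_left₀ _ hk, sub_self, Pi.zero_apply]
  rw [lapL_eq_smul_transpose_mul, Matrix.smul_mulVec, ← Matrix.mulVec_mulVec, h,
    Matrix.mulVec_zero, smul_zero]

theorem choiceProb_of_utility_eq {u : EuclideanSpace ℝ (Pair X)} {S : Finset X} {c : ℝ}
    (h : ∀ x ∈ S, utility u S x = c) {x : X} (hx : x ∈ S) :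
    choiceProb u S x = 1 / S.card := by
  have hk : (S.card : ℝ) ≠ 0 := by exact_mod_cast (Finset.card_pos.mpr ⟨_, hx⟩).ne'
  rw [choiceProb, h x hx, Finset.sum_congr rfl fun y hy => by rw [h y hy], Finset.sum_const,
    nsmul_eq_mul]
  field_simp

theorem card_pair : (Fintype.card (Pair X) : ℝ) =
    (Fintype.card X : ℝ) * ((Fintype.card X : ℝ) - 1) := by
  have h : Fintype.card (Pair X) = Fintype.card X * Fintype.card X - Fintype.card X := by
    rw [← Finset.card_univ (α := X), ← Finset.offDiag_card]
    exact Fintype.card_of_subtype _ fun p => by simp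
  rw [h, Nat.cast_sub (Nat.le_mul_self _)]
  push_cast
  ring

theorem two_le_card_pair (hn : 2 ≤ Fintype.card X) : 2 ≤ Fintype.card (Pair X) := by
  have h2 : (2 : ℝ) ≤ Fintype.card X := by exact_mod_cast hn
  have : (2 : ℝ) ≤ Fintype.card (Pair X) := by
    rw [card_pair]
    nlinarith
  exact_mod_cast this

variable {C}

/-- An empty dataset would identify all sum-zero vectors with each other, although the difference of
two unit vectors is a nonzero one. -/
theorem pos_of_identifiesCDM (hn : 2 ≤ Fintype.card X)
    (hid : IdentifiesCDM (Set.range C)) : 0 < m := by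
  rcases Nat.eq_zero_or_pos m with rfl | h
  · exfalso
    obtain ⟨p, q, hpq⟩ := Fintype.one_lt_card_iff.mp (two_le_card_pair hn)
    have h := hid (EuclideanSpace.single p 1 - EuclideanSpace.single q 1) 0
      (by simp) (by simp) fun S hS => by simp at hS
    have := congrArg (fun u : EuclideanSpace ℝ (Pair X) => u p) h
    simp [hpq] at this
  · exact h

/-- Otherwise some nonzero sum-zero `w` has wᵀLw ≤ 0, so its utilities are constant on every choice
set. Then `w` gives uniform choice probabilities, as does the zero parameter, against
identifiability. -/
theorem lambdaTwo_lapL_pos (hn : 2 ≤ Fintype.card X)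
    (hid : IdentifiesCDM (Set.range C)) : 0 < lambdaTwo (lapL C) := by
  have hm : (0 : ℝ) < m := by exact_mod_cast pos_of_identifiesCDM hn hid
  obtain ⟨w, hw0, hw1, hw⟩ := exists_le_lambdaTwo (lapL_isHermitian C) (two_le_card_pair hn)
  by_contra! hneg
  apply hw0
  rw [dotProduct_lapL_mulVec] at hw
  have hle : ∑ j, ∑ x ∈ C j,
      (utility w (C j) x - (∑ y ∈ C j, utility w (C j) y) / (C j).card) ^ 2 ≤ 0 := by
    have h1 := hw.trans (mul_nonpos_of_nonpos_of_nonneg hneg (sq_nonneg ‖w‖))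
    by_contra! h2
    have : 0 < 1 / (m : ℝ) := by positivity
    nlinarith [mul_pos this h2]
  have h0 : ∀ j, ∀ x ∈ C j,
      utility w (C j) x = (∑ y ∈ C j, utility w (C j) y) / (C j).card := fun j x hx => by
    have hin : ∀ j, 0 ≤ ∑ x ∈ C j,
        (utility w (C j) x - (∑ y ∈ C j, utility w (C j) y) / (C j).card) ^ 2 :=
      fun j => Finset.sum_nonneg fun _ _ => sq_nonneg _
    have h1 := (Finset.sum_eq_zero_iff_of_nonneg fun j _ => hin j).mp
      (le_antisymm hle (Finset.sum_nonneg fun j _ => hin j)) j (Finset.mem_univ j)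
    have h2 := (Finset.sum_eq_zero_iff_of_nonneg fun _ _ => sq_nonneg _).mp h1 x hx
    exact sub_eq_zero.mp (pow_eq_zero_iff two_ne_zero |>.mp h2)
  refine hid w 0 hw1 (by simp) ?_
  rintro _ ⟨j, rfl⟩ x hx
  rw [choiceProb_of_utility_eq (h0 j) hx,
    choiceProb_of_utility_eq (c := 0) (fun y _ => by simp [utility]) hx]

end Design

/-! ### Optimality of the estimate and curvature of the likelihood. -/

section MLE

open Filter Topology

variable {X : Type*} [Fintype X] [DecidableEq X]

theorem utility_add (u v : EuclideanSpace ℝ (Pair X)) (S : Finset X) (x : X) :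
    utility (u + v) S x = utility u S x + utility v S x := by
  simp [utility, Finset.sum_add_distrib]

theorem utility_smul (t : ℝ) (u : EuclideanSpace ℝ (Pair X)) (S : Finset X) (x : X) :
    utility (t • u) S x = t * utility u S x := by
  simp [utility, Finset.mul_sum]

theorem abs_utility_le {B : ℝ} {u : EuclideanSpace ℝ (Pair X)} (hu : u ∈ paramSet X B)
    {S : Finset X} {x : X} (hx : x ∈ S) : |utility u S x| ≤ ((S.card : ℝ) - 1) * B := by
  rw [← card_filter_pair hx, ← nsmul_eq_mul]
  exact (Finset.abs_sum_le_sum_abs _ _).trans (Finset.sum_le_card_nsmul _ _ _ fun p _ => hu.1 p)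

theorem convex_paramSet (B : ℝ) : Convex ℝ (paramSet X B) := by
  intro u hu v hv s t hs ht hst
  refine ⟨fun p => ?_, ?_⟩
  · calc |(s • u + t • v) p| = |s * u p + t * v p| := by simp
      _ ≤ |s * u p| + |t * v p| := abs_add_le _ _
      _ = s * |u p| + t * |v p| := by rw [abs_mul, abs_mul, abs_of_nonneg hs, abs_of_nonneg ht]
      _ ≤ s * B + t * B := by gcongr; exacts [hu.1 p, hv.1 p]
      _ = B := by rw [← add_mul, hst, one_mul]
  · simp [Finset.sum_add_distrib, ← Finset.mul_sum, hu.2, hv.2]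

theorem add_smul_sub_mem_paramSet {B : ℝ} {u v : EuclideanSpace ℝ (Pair X)}
    (hu : u ∈ paramSet X B) (hv : v ∈ paramSet X B) {t : ℝ} (h0 : 0 ≤ t) (h1 : t ≤ 1) :
    u + t • (v - u) ∈ paramSet X B := by
  have h := convex_paramSet B hu hv (sub_nonneg.mpr h1) h0 (sub_add_cancel 1 t)
  convert h using 1
  module

theorem derivative_nonpos_of_min_right_endpoint {f : ℝ → ℝ} {f' : ℝ} (hf : HasDerivAt f f' 1)
    (hmin : ∀ t, 0 ≤ t → t ≤ 1 → f 1 ≤ f t) : f' ≤ 0 := by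
  have h := (hasDerivWithinAt_iff_tendsto_slope' (by simp : (1 : ℝ) ∉ Set.Iio 1)).mp
    (hf.hasDerivWithinAt (s := Set.Iio 1))
  refine le_of_tendsto h ?_
  filter_upwards [Ioo_mem_nhdsLT (zero_lt_one (α := ℝ))] with t ht
  rw [slope_def_field]
  exact div_nonpos_of_nonneg_of_nonpos (sub_nonneg.mpr (hmin t ht.1.le ht.2.le))
    (by linarith [ht.2])

variable {m : ℕ} {C : Fin m → Finset X}

theorem likelihood_eq_exp (hC : ∀ j, (C j).Nonempty) (s : Fin m → X)
    (u : EuclideanSpace ℝ (Pair X)) :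
    likelihood C s u = Real.exp (-∑ j, (Real.log (∑ x ∈ C j, Real.exp (utility u (C j) x)) -
      utility u (C j) (s j))) := by
  rw [← Finset.sum_neg_distrib, Real.exp_sum, likelihood]
  refine Finset.prod_congr rfl fun j _ => ?_
  rw [neg_sub, Real.exp_sub, Real.exp_log (sum_exp_pos (hC j) _), choiceProb]

/-- The score of the log-likelihood at `u`, in the direction `v`. -/
noncomputable def score (C : Fin m → Finset X) (u : EuclideanSpace ℝ (Pair X)) (s : Fin m → X)
    (v : EuclideanSpace ℝ (Pair X)) : ℝ :=
  ∑ j, (utility v (C j) (s j) - gibbsMean (C j) (utility u (C j)) (utility v (C j)))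

theorem isLinearMap_score (u : EuclideanSpace ℝ (Pair X)) (s : Fin m → X) :
    IsLinearMap ℝ (score C u s) := by
  constructor
  · intro v w
    simp only [score, gibbsMean, utility_add, mul_add]
    rw [← Finset.sum_add_distrib]
    refine Finset.sum_congr rfl fun j _ => ?_
    rw [Finset.sum_add_distrib, add_div]
    ring
  · intro t v
    simp only [score, gibbsMean, utility_smul, smul_eq_mul, Finset.mul_sum]
    refine Finset.sum_congr rfl fun j _ => ?_
    rw [mul_sub, ← mul_div_assoc, Finset.mul_sum]
    simp only [mul_left_comm t]

/-- Let ψ be the derivative of the negative log-likelihood along the segment from `u` to `v`.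
Constrained optimality gives ψ(1) ≤ 0 even if `v` lies on the boundary, while ψ(0) is minus the
score. So the score dominates ψ(1) - ψ(0), which the mean value theorem turns into a sum of Gibbs
variances at a point of the segment; by convexity that point is in `paramSet`, where β bounds the
variances below. -/
theorem cdmBeta_mul_le_score {B : ℝ} (hB : 0 ≤ B) (hC : ∀ j, (C j).Nonempty) {K : ℕ}
    (hK : 2 ≤ K) (hCK : ∀ j, (C j).card ≤ K) {u : EuclideanSpace ℝ (Pair X)}
    (hu : u ∈ paramSet X B) {s : Fin m → X} {v : EuclideanSpace ℝ (Pair X)}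
    (hv : IsMLE B C s v) :
    cdmBeta B K * ∑ j, ∑ x ∈ C j, (utility (v - u) (C j) x -
        (∑ y ∈ C j, utility (v - u) (C j) y) / (C j).card) ^ 2 ≤ score C u s (v - u) := by
  have hline : ∀ (t : ℝ) (j : Fin m), utility (u + t • (v - u)) (C j) =
      fun x => utility u (C j) x + t * utility (v - u) (C j) x := fun t j => by
    ext x
    rw [utility_add, utility_smul]
  let ψ : ℝ → ℝ := fun t => ∑ j, (gibbsMean (C j)
    (fun x => utility u (C j) x + t * utility (v - u) (C j) x) (utility (v - u) (C j)) -
      utility (v - u) (C j) (s j))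
  have hψ1 : ψ 1 ≤ 0 := by
    have hd : HasDerivAt (fun t : ℝ => ∑ j, (Real.log (∑ x ∈ C j,
        Real.exp (utility u (C j) x + t * utility (v - u) (C j) x)) -
          (utility u (C j) (s j) + t * utility (v - u) (C j) (s j)))) (ψ 1) 1 := by
      refine HasDerivAt.fun_sum fun j _ => ?_
      refine (hasDerivAt_log_sum_exp_line (hC j) _ _ 1).fun_sub ?_
      simpa using ((hasDerivAt_id (1 : ℝ)).mul_const
        (utility (v - u) (C j) (s j))).const_add (utility u (C j) (s j))
    refine derivative_nonpos_of_min_right_endpoint hd fun t h0 h1 => ?_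
    have h : likelihood C s _ ≤ likelihood C s v :=
      hv.2 (add_smul_sub_mem_paramSet hu hv.1 h0 h1)
    -- The maximizer is viewed as the point at time 1, so that both likelihoods become values of the
    -- same function of `t`.
    have hv1 : v = u + (1 : ℝ) • (v - u) := by rw [one_smul]; abel
    rw [likelihood_eq_exp hC, hv1] at h
    rw [likelihood_eq_exp hC, Real.exp_le_exp, neg_le_neg_iff] at h
    simp only [← hv1, hline] at h
    convert h using 1
    conv_rhs => rw [hv1]
    simp only [hline]
  have hder : ∀ t, HasDerivAt ψ (∑ j, gibbsVar (C j)
      (fun x => utility u (C j) x + t * utility (v - u) (C j) x)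
        (utility (v - u) (C j))) t := fun t => by
    refine HasDerivAt.fun_sum fun j _ => ?_
    have h := (hasDerivAt_gibbsMean_line (hC j) (utility u (C j)) (utility (v - u) (C j))
      (utility (v - u) (C j)) t).sub_const (utility (v - u) (C j) (s j))
    simp only [← sq] at h
    exact h
  obtain ⟨c, hc, hslope⟩ := exists_hasDerivAt_eq_slope ψ _ zero_lt_one
    (fun t _ => (hder t).continuousAt.continuousWithinAt) fun t _ => hder t
  have hlow : cdmBeta B K * ∑ j, ∑ x ∈ C j, (utility (v - u) (C j) x -
      (∑ y ∈ C j, utility (v - u) (C j) y) / (C j).card) ^ 2 ≤ ∑ j, gibbsVar (C j)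
        (fun x => utility u (C j) x + c * utility (v - u) (C j) x)
          (utility (v - u) (C j)) := by
    rw [Finset.mul_sum]
    refine Finset.sum_le_sum fun j _ => ?_
    rw [← hline]
    exact cdmBeta_mul_le_gibbsVar (hC j) hB hK (hCK j) (fun x hx => abs_utility_le
      (add_smul_sub_mem_paramSet hu hv.1 hc.1.le hc.2.le) hx) _
  have h0 : ψ 0 = -score C u s (v - u) := by
    simp [ψ, score]
  rw [hslope, h0, sub_zero, div_one] at hlow
  linarith

end MLE

/-! ### Expectations of functions of a finite sample. -/

section FiniteSample

open MeasureTheory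

variable {X : Type*} [Fintype X] [MeasurableSpace X] [MeasurableSingletonClass X] {Ω : Type*}
  [MeasurableSpace Ω] {μ : Measure Ω} [IsProbabilityMeasure μ]

theorem integral_comp_finite {f : Ω → X} (hf : Measurable f) (φ : X → ℝ) :
    ∫ ω, φ (f ω) ∂μ = ∑ x, μ.real (f ⁻¹' {x}) * φ x := by
  have hp : IsProbabilityMeasure (μ.map f) := Measure.isProbabilityMeasure_map hf.aemeasurable
  rw [← integral_map hf.aemeasurable (measurable_of_finite φ).aestronglyMeasurable,
    integral_fintype Integrable.of_finite]
  refine Finset.sum_congr rfl fun x _ => ?_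
  rw [map_measureReal_apply hf (measurableSet_singleton x), smul_eq_mul]

/-- The sample takes finitely many values, so any `F` is measurable and integrable under its law; in
particular the choice of maximizer may be arbitrary. -/
theorem integrable_comp_sample {m : ℕ} {y : Fin m → Ω → X} (hmeas : ∀ j, Measurable (y j))
    (F : (Fin m → X) → ℝ) : Integrable (fun ω => F fun j => y j ω) μ := by
  have hY : Measurable fun ω j => y j ω := measurable_pi_lambda _ hmeas
  have hp := Measure.isProbabilityMeasure_map (μ := μ) hY.aemeasurable
  have hF : Integrable F (μ.map fun ω j => y j ω) := Integrable.of_finite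
  exact hF.comp_measurable hY

end FiniteSample

/-! ### From the score to the mean squared error. -/

section Estimation

open scoped Matrix RealInnerProductSpace
open MeasureTheory ProbabilityTheory

variable {X : Type*} [Fintype X] [DecidableEq X] {m : ℕ} {C : Fin m → Finset X}

/-- The inequality β m wᵀLw ≤ score(w) is dualized: the score is linear in w, and the sum on the
right is its squared dual norm for L on the complement of `b i₀`. -/
theorem mul_norm_sq_le_sum_score_sq {B : ℝ} (hB : 0 ≤ B) (hC : ∀ j, (C j).Nonempty) {K : ℕ}
    (hK : 2 ≤ K) (hCK : ∀ j, (C j).card ≤ K) (hm : 0 < m) {u : EuclideanSpace ℝ (Pair X)}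
    (hu : u ∈ paramSet X B) {s : Fin m → X} {v : EuclideanSpace ℝ (Pair X)}
    (hv : IsMLE B C s v) (hL : 0 < lambdaTwo (lapL C))
    {b : OrthonormalBasis (Pair X) ℝ (EuclideanSpace ℝ (Pair X))} {ev : Pair X → ℝ}
    {i₀ : Pair X} (hb : ∀ i, lapL C *ᵥ ⇑(b i) = ev i • ⇑(b i))
    (hev : ∀ i ≠ i₀, lambdaTwo (lapL C) ≤ ev i)
    (h0 : ∀ w : EuclideanSpace ℝ (Pair X), ∑ p, w p = 0 → ⟪b i₀, w⟫ = 0) :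
    lambdaTwo (lapL C) * cdmBeta B K ^ 2 * (m : ℝ) ^ 2 * ‖v - u‖ ^ 2 ≤
      ∑ i ∈ Finset.univ.erase i₀, score C u s (b i) ^ 2 / ev i := by
  have hm' : (0 : ℝ) < m := by exact_mod_cast hm
  have hβ := cdmBeta_pos hB hK
  have hw : ∑ p, (v - u) p = 0 := by
    simp [hv.1.2, hu.2]
  have hw0 := h0 _ hw
  set w := v - u with hwdef
  set Q : ℝ := ∑ i ∈ Finset.univ.erase i₀, ev i * ⟪b i, w⟫ ^ 2 with hQ
  have hquad : (m : ℝ) * Q = ∑ j, ∑ x ∈ C j, (utility w (C j) x -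
      (∑ y ∈ C j, utility w (C j) y) / (C j).card) ^ 2 := by
    have h := dotProduct_lapL_mulVec C w
    rw [dotProduct_mulVec_eq_sum_eigen hb, ← Finset.add_sum_erase _ _ (Finset.mem_univ i₀),
      hw0] at h
    simp only [← sq, zero_pow two_ne_zero, mul_zero, zero_add] at h
    rw [hQ, h]
    field_simp
  have hscore : score C u s w = ∑ i ∈ Finset.univ.erase i₀, ⟪b i, w⟫ * score C u s (b i) := by
    have h : score C u s w = ∑ i, ⟪b i, w⟫ * score C u s (b i) := by
      have hlin : ∀ w, score C u s w = (isLinearMap_score u s).mk' _ w := fun _ => rfl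
      conv_lhs => rw [hlin, ← b.sum_repr' w, map_sum]
      exact Finset.sum_congr rfl fun i _ => by rw [map_smul, smul_eq_mul, hlin]
    rw [h, ← Finset.add_sum_erase _ _ (Finset.mem_univ i₀), hw0, zero_mul, zero_add]
  have hmain := cdmBeta_mul_le_score hB hC hK hCK hu hv
  rw [← hwdef, ← hquad, hscore] at hmain
  -- Young's inequality, weighted so that the first terms add up to half of β m Q and are absorbed
  -- by the left side of `hmain`.
  have hterm : ∀ i ∈ Finset.univ.erase i₀, ⟪b i, w⟫ * score C u s (b i) ≤
      cdmBeta B K * m / 2 * (ev i * ⟪b i, w⟫ ^ 2) +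
        1 / (2 * (cdmBeta B K * m)) * (score C u s (b i) ^ 2 / ev i) := fun i hi => by
    have hei : 0 < ev i := hL.trans_le (hev i (Finset.ne_of_mem_erase hi))
    have : 0 ≤ (cdmBeta B K * m * ev i * ⟪b i, w⟫ - score C u s (b i)) ^ 2 /
        (2 * (cdmBeta B K * m) * ev i) := by positivity
    have h2 : (cdmBeta B K * m * ev i * ⟪b i, w⟫ - score C u s (b i)) ^ 2 /
        (2 * (cdmBeta B K * m) * ev i) = cdmBeta B K * m / 2 * (ev i * ⟪b i, w⟫ ^ 2) +
        1 / (2 * (cdmBeta B K * m)) * (score C u s (b i) ^ 2 / ev i) -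
          ⟪b i, w⟫ * score C u s (b i) := by
      field_simp
      ring
    linarith
  have hsum := hmain.trans (Finset.sum_le_sum hterm)
  rw [Finset.sum_add_distrib, ← Finset.mul_sum, ← Finset.mul_sum, ← hQ] at hsum
  have hQw : lambdaTwo (lapL C) * ‖w‖ ^ 2 ≤ Q := by
    rw [norm_sq_eq_sum_inner_sq b, ← Finset.add_sum_erase _ _ (Finset.mem_univ i₀), hw0,
      zero_pow two_ne_zero, zero_add, Finset.mul_sum]
    exact Finset.sum_le_sum fun i hi =>
      mul_le_mul_of_nonneg_right (hev i (Finset.ne_of_mem_erase hi)) (sq_nonneg _)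
  have hfin : (cdmBeta B K * m) ^ 2 * Q ≤
      ∑ i ∈ Finset.univ.erase i₀, score C u s (b i) ^ 2 / ev i := by
    generalize ∑ i ∈ Finset.univ.erase i₀, score C u s (b i) ^ 2 / ev i = T at hsum ⊢
    have hβm : 0 < cdmBeta B K * m := mul_pos hβ hm'
    have h1 : cdmBeta B K * m / 2 * Q ≤ 1 / (2 * (cdmBeta B K * m)) * T := by
      nlinarith
    calc (cdmBeta B K * m) ^ 2 * Q = 2 * (cdmBeta B K * m) * (cdmBeta B K * m / 2 * Q) := by ring
      _ ≤ 2 * (cdmBeta B K * m) * (1 / (2 * (cdmBeta B K * m)) * T) := by gcongr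
      _ = T := by field_simp
  calc lambdaTwo (lapL C) * cdmBeta B K ^ 2 * (m : ℝ) ^ 2 * ‖w‖ ^ 2
      = (cdmBeta B K * m) ^ 2 * (lambdaTwo (lapL C) * ‖w‖ ^ 2) := by ring
    _ ≤ (cdmBeta B K * m) ^ 2 * Q := by gcongr
    _ ≤ _ := hfin

variable [MeasurableSpace X] [MeasurableSingletonClass X] {Ω : Type*} [MeasurableSpace Ω]
  {μ : Measure Ω} [IsProbabilityMeasure μ]

/-- The law is prescribed only on `S`, but the probabilities there already sum to 1. -/
theorem measureReal_preimage_eq_zero {u : EuclideanSpace ℝ (Pair X)} {S : Finset X}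
    (hS : S.Nonempty) {f : Ω → X} (hf : Measurable f)
    (hlaw : ∀ x ∈ S, μ.real (f ⁻¹' {x}) = choiceProb u S x) {x : X} (hx : x ∉ S) :
    μ.real (f ⁻¹' {x}) = 0 := by
  have h1 : ∑ x, μ.real (f ⁻¹' {x}) = 1 := by
    simpa using (integral_comp_finite (μ := μ) hf fun _ => 1).symm
  have h2 : ∑ x ∈ S, μ.real (f ⁻¹' {x}) = 1 := by
    have h : ∀ x ∈ S, μ.real (f ⁻¹' {x}) =
        Real.exp (utility u S x) / ∑ y ∈ S, Real.exp (utility u S y) := hlaw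
    rw [Finset.sum_congr rfl h, ← Finset.sum_div]
    exact div_self (sum_exp_pos hS _).ne'
  rw [← Finset.sum_add_sum_compl S, h2, add_eq_left,
    Finset.sum_eq_zero_iff_of_nonneg fun _ _ => measureReal_nonneg] at h1
  exact h1 x (Finset.mem_compl.mpr hx)

theorem ae_mem_choiceSet {u : EuclideanSpace ℝ (Pair X)} {S : Finset X}
    (hS : S.Nonempty) {f : Ω → X} (hf : Measurable f)
    (hlaw : ∀ x ∈ S, μ.real (f ⁻¹' {x}) = choiceProb u S x) : ∀ᵐ ω ∂μ, f ω ∈ S := by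
  have h : ∀ x : X, ∀ᵐ ω ∂μ, x ∉ S → f ω ≠ x := fun x => by
    by_cases hx : x ∈ S
    · simp [hx]
    · have := (measureReal_eq_zero_iff).mp (measureReal_preimage_eq_zero hS hf hlaw hx)
      filter_upwards [measure_eq_zero_iff_ae_notMem.mp this] with ω hω _ h
      exact hω h
  filter_upwards [ae_all_iff.mpr h] with ω hω
  by_contra hn
  exact hω _ hn rfl

theorem integral_comp_eq_gibbsMean {u : EuclideanSpace ℝ (Pair X)} {S : Finset X}
    (hS : S.Nonempty) {f : Ω → X} (hf : Measurable f)
    (hlaw : ∀ x ∈ S, μ.real (f ⁻¹' {x}) = choiceProb u S x) (φ : X → ℝ) :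
    ∫ ω, φ (f ω) ∂μ = gibbsMean S (utility u S) φ := by
  rw [integral_comp_finite hf, ← Finset.sum_add_sum_compl S, gibbsMean, Finset.sum_div]
  rw [Finset.sum_eq_zero (s := Sᶜ) fun x hx => by
    rw [measureReal_preimage_eq_zero hS hf hlaw (Finset.mem_compl.mp hx), zero_mul], add_zero]
  exact Finset.sum_congr rfl fun x hx => by rw [hlaw x hx, choiceProb, div_mul_eq_mul_div]

/-- At the true parameter the score is a sum of independent centred terms, so its second moment is
the sum of their variances. Each is a Gibbs variance, bounded by the centred sum of squares from
which L is built. -/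
theorem integral_score_sq_le (hC : ∀ j, (C j).Nonempty) (u : EuclideanSpace ℝ (Pair X))
    {y : Fin m → Ω → X} (hmeas : ∀ j, Measurable (y j)) (hindep : iIndepFun y μ)
    (hlaw : ∀ j, ∀ x ∈ C j, μ.real (y j ⁻¹' {x}) = choiceProb u (C j) x)
    (v : EuclideanSpace ℝ (Pair X)) :
    ∫ ω, score C u (fun j => y j ω) v ^ 2 ∂μ ≤
      (m : ℝ) * ((v : Pair X → ℝ) ⬝ᵥ lapL C *ᵥ (v : Pair X → ℝ)) := by
  let g : Fin m → X → ℝ := fun j x =>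
    utility v (C j) x - gibbsMean (C j) (utility u (C j)) (utility v (C j))
  have hg : ∀ j, Measurable (g j) := fun j => measurable_of_finite _
  have hgy : ∀ j, Measurable fun ω => g j (y j ω) := fun j => (hg j).comp (hmeas j)
  have hLp : ∀ j, MemLp (fun ω => g j (y j ω)) 2 μ := fun j => by
    refine MemLp.of_bound (hgy j).aestronglyMeasurable (∑ x, ‖g j x‖)
      (Filter.Eventually.of_forall fun ω => ?_)
    exact Finset.single_le_sum (f := fun x => ‖g j x‖) (fun _ _ => norm_nonneg _)
      (Finset.mem_univ (y j ω))
  have hmean : ∀ j, ∫ ω, g j (y j ω) ∂μ = 0 := fun j => by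
    rw [integral_comp_eq_gibbsMean (hC j) (hmeas j) (hlaw j)]
    have hZ := (sum_exp_pos (hC j) (utility u (C j))).ne'
    simp only [g]
    generalize hM : gibbsMean (C j) (utility u (C j)) (utility v (C j)) = M
    rw [gibbsMean] at hM ⊢
    simp only [mul_sub, Finset.sum_sub_distrib, ← Finset.sum_mul, sub_div, hM]
    field_simp
    ring
  have hvar : ∀ j, Var[fun ω => g j (y j ω); μ] = gibbsVar (C j) (utility u (C j))
      (utility v (C j)) := fun j => by
    rw [variance_of_integral_eq_zero (hgy j).aemeasurable (hmean j),
      integral_comp_eq_gibbsMean (hC j) (hmeas j) (hlaw j) fun x => g j x ^ 2]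
    simp only [g]
    rw [gibbsMean_sq_sub (hC j)]
    ring
  have hsum : Var[∑ j, fun ω => g j (y j ω); μ] = ∑ j, Var[fun ω => g j (y j ω); μ] :=
    IndepFun.variance_sum (fun j _ => hLp j) fun i _ j _ hij =>
      (hindep.indepFun hij).comp (hg i) (hg j)
  rw [variance_of_integral_eq_zero] at hsum
  · calc ∫ ω, score C u (fun j => y j ω) v ^ 2 ∂μ
        = ∑ j, Var[fun ω => g j (y j ω); μ] := by
          rw [← hsum]
          simp [score, g]
      _ ≤ ∑ j, ∑ x ∈ C j, (utility v (C j) x -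
            (∑ y ∈ C j, utility v (C j) y) / (C j).card) ^ 2 := by
          refine Finset.sum_le_sum fun j _ => ?_
          rw [hvar]
          exact gibbsVar_le_sum_sub_average_sq (hC j) _ _
      _ = _ := by
          rw [dotProduct_lapL_mulVec]
          rcases Nat.eq_zero_or_pos m with rfl | hm
          · simp
          · field_simp
  · exact (Finset.aemeasurable_sum _ fun j _ => (hgy j).aemeasurable)
  · simp only [Finset.sum_apply]
    rw [integral_finsetSum _ fun j _ => (hLp j).integrable one_le_two]
    exact Finset.sum_eq_zero fun j _ => hmean j

/-- In an eigenbasis of L each normalized squared score has mean at most m, whatever its eigenvalue,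
so the count of the eigenvectors other than `b i₀` produces the factor d. -/
theorem integral_norm_sq_le {B : ℝ} (hB : 0 ≤ B) (hC : ∀ j, (C j).Nonempty) {K : ℕ}
    (hK : 2 ≤ K) (hCK : ∀ j, (C j).card ≤ K) (hn : 2 ≤ Fintype.card X)
    (hid : IdentifiesCDM (Set.range C)) {u : EuclideanSpace ℝ (Pair X)} (hu : u ∈ paramSet X B)
    {y : Fin m → Ω → X} (hmeas : ∀ j, Measurable (y j)) (hindep : iIndepFun y μ)
    (hlaw : ∀ j, ∀ x ∈ C j, μ.real (y j ⁻¹' {x}) = choiceProb u (C j) x)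
    {uMLE : (Fin m → X) → EuclideanSpace ℝ (Pair X)}
    (hMLE : ∀ s : Fin m → X, (∀ j, s j ∈ C j) → IsMLE B C s (uMLE s)) :
    ∫ ω, ‖uMLE (fun j => y j ω) - u‖ ^ 2 ∂μ ≤
      numFreeParams X / (lambdaTwo (lapL C) * cdmBeta B K ^ 2 * m) := by
  have hm := pos_of_identifiesCDM hn hid
  have hm' : (0 : ℝ) < m := by exact_mod_cast hm
  have hL := lambdaTwo_lapL_pos hn hid
  have hβ := cdmBeta_pos hB hK
  obtain ⟨b, ev, i₀, hb, hev, h0⟩ := exists_eigenbasis_of_mulVec_one (lapL_isHermitian C)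
    (two_le_card_pair hn) (lapL_mulVec_one C) hL
  have hmem : ∀ᵐ ω ∂μ, ∀ j, y j ω ∈ C j :=
    -- The estimator is a maximizer only for samples inside the choice sets, which is almost every
    -- sample.
    ae_all_iff.mpr fun j => ae_mem_choiceSet (hC j) (hmeas j) (hlaw j)
  have hscore : ∀ i ≠ i₀, ∫ ω, score C u (fun j => y j ω) (b i) ^ 2 / ev i ∂μ ≤ m :=
    fun i hi => by
      have hei := hL.trans_le (hev i hi)
      rw [integral_div, div_le_iff₀ hei]
      refine (integral_score_sq_le hC u hmeas hindep hlaw (b i)).trans_eq ?_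
      rw [dotProduct_mulVec_eq_sum_eigen hb]
      simp [OrthonormalBasis.inner_eq_ite]
  have hcard : ((Finset.univ.erase i₀).card : ℝ) = numFreeParams X := by
    have : 1 ≤ Fintype.card (Pair X) := (by norm_num : 1 ≤ 2).trans (two_le_card_pair hn)
    rw [Finset.card_erase_of_mem (Finset.mem_univ _), Finset.card_univ, Nat.cast_sub this,
      card_pair, numFreeParams, Nat.cast_one]
  have hint : lambdaTwo (lapL C) * cdmBeta B K ^ 2 * (m : ℝ) ^ 2 *
      ∫ ω, ‖uMLE (fun j => y j ω) - u‖ ^ 2 ∂μ ≤ numFreeParams X * m := by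
    rw [← integral_const_mul]
    calc _ ≤ ∫ ω, ∑ i ∈ Finset.univ.erase i₀, score C u (fun j => y j ω) (b i) ^ 2 / ev i ∂μ := by
          refine integral_mono_ae
            (integrable_comp_sample hmeas fun s => _ * ‖uMLE s - u‖ ^ 2)
            (integrable_comp_sample hmeas fun s =>
              ∑ i ∈ Finset.univ.erase i₀, score C u s (b i) ^ 2 / ev i) ?_
          filter_upwards [hmem] with ω hω
          exact mul_norm_sq_le_sum_score_sq hB hC hK hCK hm hu (hMLE _ hω) hL hb hev h0
      _ = ∑ i ∈ Finset.univ.erase i₀, ∫ ω, score C u (fun j => y j ω) (b i) ^ 2 / ev i ∂μ :=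
          integral_finsetSum _ fun i _ =>
            integrable_comp_sample hmeas fun s => score C u s (b i) ^ 2 / ev i
      _ ≤ (Finset.univ.erase i₀).card • (m : ℝ) :=
          Finset.sum_le_card_nsmul _ _ _ fun i hi => hscore i (Finset.ne_of_mem_erase hi)
      _ = numFreeParams X * m := by rw [nsmul_eq_mul, hcard]
  rw [le_div_iff₀ (by positivity)]
  refine le_of_mul_le_mul_right ?_ hm'
  calc _ = _ := by ring
    _ ≤ _ := hint

end Estimation

theorem theorem3 {X : Type*} [Fintype X] [DecidableEq X] [MeasurableSpace X]
    [MeasurableSingletonClass X] (hn : 2 ≤ Fintype.card X)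
    {m : ℕ} (C : Fin m → Finset X) (hC : ∀ j, 2 ≤ (C j).card)
    (hid : IdentifiesCDM (Set.range C))
    (B : ℝ) (uStar : EuclideanSpace ℝ (Pair X)) (hu : uStar ∈ paramSet X B)
    {Ω : Type*} [MeasurableSpace Ω] (μ : MeasureTheory.Measure Ω)
    [MeasureTheory.IsProbabilityMeasure μ]
    (y : Fin m → Ω → X) (hmeas : ∀ j, Measurable (y j))
    (hindep : ProbabilityTheory.iIndepFun y μ)
    (hlaw : ∀ j, ∀ x ∈ C j, μ.real (y j ⁻¹' {x}) = choiceProb uStar (C j) x)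
    (uMLE : (Fin m → X) → EuclideanSpace ℝ (Pair X))
    (hMLE : ∀ s : Fin m → X, (∀ j, s j ∈ C j) → IsMLE B C s (uMLE s)) :
    0 < lambdaTwo (lapL C) ∧
    0 < cdmBeta B (kMax C) ∧
    lapL C = (1 / (m : ℝ)) • ((scaledDesignMatrix C).transpose * scaledDesignMatrix C) ∧
    MeasureTheory.Integrable (fun ω => ‖uMLE (fun j => y j ω) - uStar‖ ^ 2) μ ∧
    (3 ≤ Fintype.card X →
      ∫ ω, ‖uMLE (fun j => y j ω) - uStar‖ ^ 2 ∂μ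
        ≤ cdmConst B C * ((numFreeParams X - 1) / (m : ℝ))) ∧
    ∫ ω, ‖uMLE (fun j => y j ω) - uStar‖ ^ 2 ∂μ
      ≤ cdmConst B C * (numFreeParams X / (m : ℝ)) := by
  have hC0 : ∀ j, (C j).Nonempty := fun j => Finset.card_pos.mp (by have := hC j; omega)
  have hm := pos_of_identifiesCDM hn hid
  have hm' : (0 : ℝ) < m := by exact_mod_cast hm
  have hCK : ∀ j, (C j).card ≤ kMax C := fun j =>
    Finset.le_sup (f := fun j => (C j).card) (Finset.mem_univ j)
  have hK : 2 ≤ kMax C := (hC ⟨0, hm⟩).trans (hCK _)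
  -- A coordinate exists because n ≥ 2, and `B` bounds its absolute value.
  have hB : 0 ≤ B := by
    obtain ⟨p, -⟩ := Fintype.one_lt_card_iff.mp (two_le_card_pair hn)
    exact (abs_nonneg _).trans (hu.1 p)
  have hL := lambdaTwo_lapL_pos hn hid
  have hβ := cdmBeta_pos hB hK
  have hmain := integral_norm_sq_le hB hC0 hK hCK hn hid hu hmeas hindep hlaw hMLE
  -- The numerator 2 of `cdmConst` is not needed by the argument, so the proved bound has d/2 in
  -- place of d.
  have hform : numFreeParams X / (lambdaTwo (lapL C) * cdmBeta B (kMax C) ^ 2 * m) =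
      cdmConst B C * (numFreeParams X / 2 / m) := by
    rw [cdmConst]
    field_simp
  rw [hform] at hmain
  have hc : 0 ≤ cdmConst B C := by
    rw [cdmConst]
    positivity
  have hn' : (2 : ℝ) ≤ Fintype.card X := by exact_mod_cast hn
  refine ⟨hL, hβ, lapL_eq_smul_transpose_mul C,
    integrable_comp_sample hmeas fun s => ‖uMLE s - uStar‖ ^ 2, fun h3 => hmain.trans ?_,
    hmain.trans ?_⟩
  · have h3' : (3 : ℝ) ≤ Fintype.card X := by exact_mod_cast h3
    -- This needs d ≥ 2; n ≥ 3 gives d ≥ 5, whereas n = 2 has d = 1.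
    have hd : numFreeParams X / 2 ≤ numFreeParams X - 1 := by
      rw [numFreeParams]
      nlinarith
    gcongr
  · have hd : numFreeParams X / 2 ≤ numFreeParams X := by
      rw [numFreeParams]
      nlinarith
    gcongr
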